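/- **Theorem.** Let $f:[0,1]\to\mathbb{R}$ be a continuous, concave, non-increasing function with $f(0)=1$ and $f(1)\ge 0$, and let $$K_f=\{(x,y): 0\le x\le 1,\ 0\le y\le f(x)\}.$$ Assume that $K_f$ is not the unit square $[0,1]^2$. For $0\le x\le 1$ let $$S^f(x)=\bigl([0,x]\times[0,1]\bigr)\cup\bigl([0,1]\times[0,f(x)]\bigr)$$ be the polygon with consecutive vertices $(0,0),(0,1),(x,1),(x,f(x)),(1,f(x)),(1,0)$, let $|S|$ denote the area of $S$, and let $$\mathcal{X}^f=\Bigl\{x\in[0,1] : |S^f(x)|=\min_{0\le t\le 1}|S^f(t)|\Bigr\}.$$ For linearly independent $v,w\in\mathbb{R}^2$ let $\mathcal{L}(v,w)=\{kv+lw : k,l\in\mathbb{Z}\}$; sets of this form are the lattices of $\mathbb{R}^2$. For a convex disk $K$ (a compact convex set in $\mathbb{R}^2$ with an interior point) and a lattice $\Lambda$, let $K+\Lambda$ be the family of translates $K+u$, $u\in\Lambda$; it is a packing if its members have mutually disjoint interiors. Let $rB$ be the closed Euclidean disc of radius $r$ about the origin. The upper density of a family of convex disks is the limit superior, as $r\to\infty$,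 of the total area of the members meeting $rB$ divided by $|rB|$; the lower density is the limit inferior of the total area of the members contained in $rB$ divided by $|rB|$; the family has density $d$ if both are equal to $d$. Let $\delta_L(K)$ be the supremum of the upper densities of all packings $K+\Lambda$ with $\Lambda$ a lattice, and let $\Delta(K)$ be the set of optimal packing lattices of $K$, that is, of all lattices $\Lambda$ such that $K+\Lambda$ is a packing of density $\delta_L(K)$. Then the map $$\Lambda^f(x)=\mathcal{L}\bigl((x-1,1),(x,f(x))\bigr)$$ is a bijection from $\mathcal{X}^f$ onto $\Delta(K_f)$. -/

import Mathlib

open Set Filter MeasureTheory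
open scoped ENNReal

namespace ConvexDisk

/-- The closed Euclidean disc of radius `r` about the origin. (The ball of the normed space
`ℝ × ℝ` is a square, so the disc is written out.) -/
def disc (r : ℝ) : Set (ℝ × ℝ) := {p | 0 ≤ r ∧ p.1 ^ 2 + p.2 ^ 2 ≤ r ^ 2}

/-- The lattice `{k v + l w : k, l ∈ ℤ}` generated by `v` and `w`. -/
def lattice (v w : ℝ × ℝ) : Submodule ℤ (ℝ × ℝ) := Submodule.span ℤ {v, w}

theorem mem_lattice {v w p : ℝ × ℝ} :
    p ∈ lattice v w ↔ ∃ k l : ℤ, k • v + l • w = p :=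
  Submodule.mem_span_pair

/-- A lattice in the plane: generated by two linearly independent vectors. -/
def IsLattice (Λ : Submodule ℤ (ℝ × ℝ)) : Prop :=
  ∃ v w : ℝ × ℝ, LinearIndependent ℝ ![v, w] ∧ Λ = lattice v w

/-- The family `K + Λ` of the translates of `K` by the vectors of `Λ`. -/
def translates (K : Set (ℝ × ℝ)) (Λ : Submodule ℤ (ℝ × ℝ)) : Λ → Set (ℝ × ℝ) :=
  fun u => (fun p => p + (u : ℝ × ℝ)) '' K

/-- A packing of the whole plane: the interiors of the members are mutually disjoint. -/
def IsPacking {ι : Type*} (F : ι → Set (ℝ × ℝ)) : Prop :=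
  Pairwise fun i j => Disjoint (interior (F i)) (interior (F j))

/-- Upper density of a family: `limsup` of the total area of the members that meet the disc of
radius `r`, divided by the area of that disc. -/
noncomputable def upperDensity {ι : Type*} (F : ι → Set (ℝ × ℝ)) : ℝ≥0∞ :=
  limsup (fun r : ℝ =>
    (∑' i : {i : ι // (F i ∩ disc r).Nonempty}, volume (F i)) / volume (disc r)) atTop

/-- Lower density of a family: `liminf` of the total area of the members contained in the disc of
radius `r`, divided by the area of that disc. -/
noncomputable def lowerDensity {ι : Type*} (F : ι → Set (ℝ × ℝ)) : ℝ≥0∞ :=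
  liminf (fun r : ℝ =>
    (∑' i : {i : ι // F i ⊆ disc r}, volume (F i)) / volume (disc r)) atTop

/-- The family has density `d`: its upper and its lower density are both `d`. -/
def HasDensity {ι : Type*} (F : ι → Set (ℝ × ℝ)) (d : ℝ≥0∞) : Prop :=
  upperDensity F = d ∧ lowerDensity F = d

/-- The lattice packing density `δ_L(K)`. -/
noncomputable def latticePackingDensity (K : Set (ℝ × ℝ)) : ℝ≥0∞ :=
  sSup {d | ∃ Λ : Submodule ℤ (ℝ × ℝ),
    IsLattice Λ ∧ IsPacking (translates K Λ) ∧ d = upperDensity (translates K Λ)}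

/-- The set `Δ(K)` of the optimal packing lattices of `K`. -/
def optimalPackingLattices (K : Set (ℝ × ℝ)) : Set (Submodule ℤ (ℝ × ℝ)) :=
  {Λ | IsLattice Λ ∧ IsPacking (translates K Λ) ∧
    HasDensity (translates K Λ) (latticePackingDensity K)}

/-- The region `K_f` under the graph of `f` over `[0, 1]`. -/
def region (f : ℝ → ℝ) : Set (ℝ × ℝ) :=
  {p | 0 ≤ p.1 ∧ p.1 ≤ 1 ∧ 0 ≤ p.2 ∧ p.2 ≤ f p.1}

/-- The polygon `S^f(x)` with the consecutive vertices
`(0,0), (0,1), (x,1), (x,f(x)), (1,f(x)), (1,0)`, as the union of the two rectangles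
`[0,x] × [0,1]` and `[0,1] × [0,f(x)]`. -/
def stair (f : ℝ → ℝ) (x : ℝ) : Set (ℝ × ℝ) :=
  Icc 0 x ×ˢ Icc 0 1 ∪ Icc 0 1 ×ˢ Icc 0 (f x)

/-- The set `X^f` of the `x ∈ [0, 1]` for which the area of `S^f(x)` is minimal. -/
def minimizers (f : ℝ → ℝ) : Set ℝ :=
  {x | x ∈ Icc (0 : ℝ) 1 ∧ ∀ t ∈ Icc (0 : ℝ) 1, volume (stair f x) ≤ volume (stair f t)}

end ConvexDisk

/-! A lattice arrangement of `K_f` has density area over determinant (`hasDensity_translates`), so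
the optimal packing lattices are the packing lattices of least determinant. The lattice of `x` has
determinant `stairArea f x`, the area of the stair polygon, and it packs because translates of that
polygon tile the plane (`isPacking_stairLattice`).

For the lower bound, a packing lattice has no nonzero vector interior to the difference body of
`K_f`; only the consequences recorded in `Admissible` are needed. A basis reduced with respect to
the strip `|x| < 1` (`exists_reduced_basis`) shows that the determinant is at least 1, or that the
lattice is generated by `(-a, b)` and `(c, d)` with `a ≥ 1 - c`, `b ≥ 1`, `d ≥ f c`
(`Admissible.exists_generators`). In the second case the determinant `c b + a d` is at least `c + (1
- c) f c = stairArea f c`, and equality forces `a = 1 - c`, `b = 1`, `d = f c`, so the lattice is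
that of `c` (`Admissible.le_abs_cross`). In the first case the lattice is not optimal: as `K_f` is
not the square, some stair polygon has area less than 1.

Injectivity holds because the lattices of `x < y` cannot agree: a common lattice would contain the
short horizontal vector `(y - x, 0)`. -/

open scoped Topology Pointwise

namespace ConvexDisk

/-! ### Determinants, and areas of Euclidean discs. -/

/-- The determinant of the matrix with the columns `v` and `w`. -/
def cross (v w : ℝ × ℝ) : ℝ := v.1 * w.2 - v.2 * w.1

theorem linearIndependent_pair_iff_cross_ne_zero {v w : ℝ × ℝ} :
    LinearIndependent ℝ ![v, w] ↔ cross v w ≠ 0 := by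
  rw [LinearIndependent.pair_iff]
  unfold cross
  constructor
  · intro h h0
    have h1 := h w.2 (-v.2) (by
      ext
      · simp; linarith
      · simp; ring)
    have h2 := h w.1 (-v.1) (by
      ext
      · simp; ring
      · simp; linarith)
    have h3 := h 1 0 (by
      ext
      · simp; linarith [h2.2]
      · simp; linarith [h1.2])
    simp at h3
  · intro h s t hst
    have e1 := congrArg Prod.fst hst
    have e2 := congrArg Prod.snd hst
    simp at e1 e2
    constructor
    · refine (mul_eq_zero.1 (?_ : s * (v.1 * w.2 - v.2 * w.1) = 0)).resolve_right h
      linear_combination w.2 * e1 - w.1 * e2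
    · refine (mul_eq_zero.1 (?_ : t * (v.1 * w.2 - v.2 * w.1) = 0)).resolve_right h
      linear_combination v.1 * e2 - v.2 * e1

theorem disc_eq_smul {r : ℝ} (hr : 0 < r) : disc r = r • disc 1 := by
  ext p
  rw [mem_smul_set_iff_inv_smul_mem₀ hr.ne']
  simp only [disc, mem_ofPred_eq, Prod.smul_fst, Prod.smul_snd, smul_eq_mul, zero_le_one, true_and,
    hr.le, mul_pow, ← mul_add, one_pow]
  rw [inv_pow, inv_mul_le_one₀ (by positivity)]

/-- Quadratic scaling suffices: the area of the unit disc cancels in every density and is never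
evaluated. -/
theorem volume_disc {r : ℝ} (hr : 0 < r) :
    volume (disc r) = ENNReal.ofReal (r ^ 2) * volume (disc 1) := by
  rw [disc_eq_smul hr, Measure.addHaar_smul]
  simp

theorem isBounded_disc (r : ℝ) : Bornology.IsBounded (disc r) := by
  refine (Metric.isBounded_closedBall (x := (0 : ℝ × ℝ)) (r := r)).subset ?_
  rintro p ⟨h0, h⟩
  rw [mem_closedBall_zero_iff, Prod.norm_def, max_le_iff, Real.norm_eq_abs, Real.norm_eq_abs]
  exact ⟨abs_le_of_sq_le_sq (by nlinarith [sq_nonneg p.2]) h0,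
    abs_le_of_sq_le_sq (by nlinarith [sq_nonneg p.1]) h0⟩

theorem volume_disc_one_ne_top : volume (disc 1) ≠ ∞ :=
  (isBounded_disc 1).measure_lt_top.ne

theorem volume_disc_one_ne_zero : volume (disc 1) ≠ 0 := by
  have h : Metric.ball (0 : ℝ × ℝ) (1 / 2) ⊆ disc 1 := by
    intro p hp
    rw [mem_ball_zero_iff, Prod.norm_def, max_lt_iff, Real.norm_eq_abs, Real.norm_eq_abs,
      abs_lt, abs_lt] at hp
    exact ⟨zero_le_one, by nlinarith⟩
  exact ((Metric.measure_ball_pos volume _ (by norm_num)).trans_le (measure_mono h)).ne'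

theorem add_mem_disc {a b : ℝ} {p q : ℝ × ℝ} (hp : p ∈ disc a) (hq : q ∈ disc b) :
    p + q ∈ disc (a + b) := by
  obtain ⟨ha, hp⟩ := hp
  obtain ⟨hb, hq⟩ := hq
  refine ⟨add_nonneg ha hb, ?_⟩
  have h : p.1 * q.1 + p.2 * q.2 ≤ a * b := by
    refine le_of_abs_le (abs_le_of_sq_le_sq ?_ (mul_nonneg ha hb))
    calc (p.1 * q.1 + p.2 * q.2) ^ 2 ≤ (p.1 ^ 2 + p.2 ^ 2) * (q.1 ^ 2 + q.2 ^ 2) := by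
          nlinarith [sq_nonneg (p.1 * q.2 - p.2 * q.1)]
      _ ≤ a ^ 2 * b ^ 2 := by gcongr
      _ = (a * b) ^ 2 := by ring
  simp only [Prod.fst_add, Prod.snd_add]
  nlinarith

theorem neg_mem_disc {a : ℝ} {p : ℝ × ℝ} (hp : p ∈ disc a) : -p ∈ disc a := by
  simpa [disc] using hp

theorem exists_subset_disc {K : Set (ℝ × ℝ)} (hK : Bornology.IsBounded K) :
    ∃ R, 0 ≤ R ∧ K ⊆ disc R := by
  obtain ⟨R, hR, h⟩ := hK.exists_pos_norm_le
  -- The norm is the sup norm, so a factor of at least √2 is needed.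
  refine ⟨2 * R, by positivity, fun p hp => ⟨by positivity, ?_⟩⟩
  have h1 := h p hp
  rw [Prod.norm_def, max_le_iff, Real.norm_eq_abs, Real.norm_eq_abs] at h1
  nlinarith [sq_le_sq' (abs_le.1 h1.1).1 (abs_le.1 h1.1).2,
    sq_le_sq' (abs_le.1 h1.2).1 (abs_le.1 h1.2).2]

theorem tendsto_volume_disc_add_div (c : ℝ) :
    Tendsto (fun r : ℝ => volume (disc (r + c)) / volume (disc r)) atTop (𝓝 1) := by
  have h1 : Tendsto (fun r : ℝ => ENNReal.ofReal ((1 + c / r) ^ 2)) atTop (𝓝 1) := by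
    have : Tendsto (fun r : ℝ => (1 + c / r) ^ 2) atTop (𝓝 ((1 + 0) ^ 2)) :=
      (tendsto_const_nhds.add (tendsto_const_nhds.div_atTop tendsto_id)).pow 2
    simpa using ENNReal.tendsto_ofReal this
  refine h1.congr' ?_
  filter_upwards [eventually_gt_atTop 0, eventually_gt_atTop (-c)] with r hr hrc
  rw [volume_disc hr, volume_disc (by linarith : 0 < r + c),
    ENNReal.mul_div_mul_right _ _ volume_disc_one_ne_zero volume_disc_one_ne_top,
    ← ENNReal.ofReal_div_of_pos (by positivity), ← div_pow, add_div, div_self hr.ne']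

/-! ### Density of a lattice arrangement. -/

/-- The linear map `(s, t) ↦ s v + t w`. -/
def combination (v w : ℝ × ℝ) : ℝ × ℝ →ₗ[ℝ] ℝ × ℝ :=
  (LinearMap.toSpanSingleton ℝ _ v).coprod (LinearMap.toSpanSingleton ℝ _ w)

theorem combination_apply (v w p : ℝ × ℝ) : combination v w p = p.1 • v + p.2 • w := rfl

theorem det_combination (v w : ℝ × ℝ) : LinearMap.det (combination v w) = cross v w := by
  rw [← LinearMap.det_toMatrix (Module.Basis.finTwoProd ℝ), Matrix.det_fin_two]
  simp [LinearMap.toMatrix_apply, combination_apply, cross]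
  ring

theorem combination_bijective {v w : ℝ × ℝ} (h : cross v w ≠ 0) :
    Function.Bijective (combination v w) := by
  rw [← det_combination] at h
  exact (LinearMap.equivOfDetNeZero _ h).bijective

/-- The half-open parallelogram spanned by `v` and `w`. -/
def cell (v w : ℝ × ℝ) : Set (ℝ × ℝ) := combination v w '' (Ico 0 1 ×ˢ Ico 0 1)

theorem volume_cell (v w : ℝ × ℝ) : volume (cell v w) = ENNReal.ofReal |cross v w| := by
  rw [cell, Measure.addHaar_image_linearMap, det_combination, Measure.volume_eq_prod,
    Measure.prod_prod]
  simp

theorem measurableSet_cell {v w : ℝ × ℝ} (h : cross v w ≠ 0) : MeasurableSet (cell v w) :=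
  (LinearMap.continuous_of_finiteDimensional _).measurable.measurableEmbedding
    (combination_bijective h).1 |>.measurableSet_image.2 (measurableSet_Ico.prod measurableSet_Ico)

theorem isBounded_cell (v w : ℝ × ℝ) : Bornology.IsBounded (cell v w) := by
  have h : IsCompact (combination v w '' (Icc 0 1 ×ˢ Icc 0 1)) :=
    (isCompact_Icc.prod isCompact_Icc).image (LinearMap.continuous_of_finiteDimensional _)
  exact h.isBounded.subset (image_mono (prod_mono Ico_subset_Icc_self Ico_subset_Icc_self))

theorem pairwise_disjoint_translates_cell {v w : ℝ × ℝ} (h : cross v w ≠ 0) :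
    Pairwise fun i j => Disjoint (translates (cell v w) (lattice v w) i)
      (translates (cell v w) (lattice v w) j) := by
  rintro ⟨i, hi⟩ ⟨j, hj⟩ hij
  rw [Set.disjoint_left]
  rintro _ ⟨_, ⟨p, ⟨⟨hp1, hp1'⟩, hp2, hp2'⟩, rfl⟩, rfl⟩ ⟨_, ⟨q, ⟨⟨hq1, hq1'⟩, hq2, hq2'⟩, rfl⟩, he⟩
  apply hij
  obtain ⟨k, l, rfl⟩ := mem_lattice.1 hi
  obtain ⟨m, n, rfl⟩ := mem_lattice.1 hj
  have e : combination v w (q + ((m : ℝ), (n : ℝ))) = combination v w (p + ((k : ℝ), (l : ℝ))) := by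
    rw [map_add, map_add]
    simpa [combination_apply, Int.cast_smul_eq_zsmul] using he
  have e := (combination_bijective h).1 e
  have e1 : q.1 + m = p.1 + k := congrArg Prod.fst e
  have e2 : q.2 + n = p.2 + l := congrArg Prod.snd e
  have a1 : (k : ℝ) < m + 1 := by linarith
  have a2 : (m : ℝ) < k + 1 := by linarith
  have a3 : (l : ℝ) < n + 1 := by linarith
  have a4 : (n : ℝ) < l + 1 := by linarith
  norm_cast at a1 a2 a3 a4
  obtain rfl : k = m := by omega
  obtain rfl : l = n := by omega
  rfl

theorem exists_mem_translates_cell {v w : ℝ × ℝ} (h : cross v w ≠ 0) (p : ℝ × ℝ) :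
    ∃ i, p ∈ translates (cell v w) (lattice v w) i := by
  obtain ⟨q, rfl⟩ := (combination_bijective h).2 p
  refine ⟨⟨⌊q.1⌋ • v + ⌊q.2⌋ • w, mem_lattice.2 ⟨_, _, rfl⟩⟩, combination v w
    (Int.fract q.1, Int.fract q.2), ⟨_, ⟨⟨Int.fract_nonneg _, Int.fract_lt_one _⟩,
      ⟨Int.fract_nonneg _, Int.fract_lt_one _⟩⟩, rfl⟩, ?_⟩
  simp only [combination_apply, Int.fract, sub_smul, Int.cast_smul_eq_zsmul]
  abel

theorem volume_translates (K : Set (ℝ × ℝ)) (Λ : Submodule ℤ (ℝ × ℝ)) (i : Λ) :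
    volume (translates K Λ i) = volume K := by
  rw [translates, image_add_right, measure_preimage_add_right]

instance countable_lattice (v w : ℝ × ℝ) : Countable (lattice v w) := by
  refine (Function.Surjective.countable (f := fun k : ℤ × ℤ =>
    (⟨k.1 • v + k.2 • w, mem_lattice.2 ⟨_, _, rfl⟩⟩ : lattice v w)) ?_)
  rintro ⟨p, hp⟩
  obtain ⟨k, l, rfl⟩ := mem_lattice.1 hp
  exact ⟨(k, l), rfl⟩

theorem measurableSet_translates_cell {v w : ℝ × ℝ} (h : cross v w ≠ 0) (i : lattice v w) :
    MeasurableSet (translates (cell v w) (lattice v w) i) := by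
  rw [translates, image_add_right]
  exact measurable_add_const _ (measurableSet_cell h)

/-- The cells attached to the counted translates are disjoint and lie in a slightly larger disc; `K`
and the cell each account for one `R`. -/
theorem card_meeting_mul_le {K : Set (ℝ × ℝ)} {v w : ℝ × ℝ} (h : cross v w ≠ 0) {R : ℝ}
    (hK : K ⊆ disc R) (hc : cell v w ⊆ disc R) (r : ℝ) :
    ENat.card {i : lattice v w // (translates K (lattice v w) i ∩ disc r).Nonempty} *
      ENNReal.ofReal |cross v w| ≤ volume (disc (r + 2 * R)) := by
  rw [← volume_cell, ← ENNReal.tsum_const]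
  calc _ = ∑' i : {i : lattice v w // (translates K (lattice v w) i ∩ disc r).Nonempty},
        volume (translates (cell v w) (lattice v w) i) := by simp_rw [volume_translates]
    _ = volume (⋃ i : {i : lattice v w // (translates K (lattice v w) i ∩ disc r).Nonempty},
        translates (cell v w) (lattice v w) i) := by
      rw [measure_iUnion _ fun i => measurableSet_translates_cell h _]
      intro i j hij
      exact pairwise_disjoint_translates_cell h fun e => hij (Subtype.ext e)
    _ ≤ _ := by
      refine measure_mono (iUnion_subset ?_)
      rintro ⟨i, _, ⟨k, hk, rfl⟩, hr⟩ _ ⟨p, hp, rfl⟩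
      have := add_mem_disc (hc hp) (add_mem_disc hr (neg_mem_disc (hK hk)))
      convert this using 1
      · ring_nf
      · simp

/-- Dual to `card_meeting_mul_le`: a cell that meets the smaller disc belongs to a translate
contained in `disc r`, and the cells cover the plane. -/
theorem le_card_contained_mul {K : Set (ℝ × ℝ)} {v w : ℝ × ℝ} (h : cross v w ≠ 0) {R : ℝ}
    (hK : K ⊆ disc R) (hc : cell v w ⊆ disc R) (r : ℝ) :
    volume (disc (r + -(2 * R))) ≤ ENat.card {i : lattice v w // translates K (lattice v w) i ⊆
      disc r} * ENNReal.ofReal |cross v w| := by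
  rw [← volume_cell, ← ENNReal.tsum_const]
  calc _ ≤ volume (⋃ i : {i : lattice v w // translates K (lattice v w) i ⊆ disc r},
        translates (cell v w) (lattice v w) i) := by
        refine measure_mono fun p hp => mem_iUnion.2 ?_
        obtain ⟨i, hi⟩ := exists_mem_translates_cell h p
        refine ⟨⟨i, ?_⟩, hi⟩
        obtain ⟨q, hq, rfl⟩ := hi
        rintro _ ⟨k, hk, rfl⟩
        have := add_mem_disc (hK hk) (add_mem_disc hp (neg_mem_disc (hc hq)))
        convert this using 1
        · ring_nf
        · simp
    _ ≤ ∑' i : {i : lattice v w // translates K (lattice v w) i ⊆ disc r},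
        volume (translates (cell v w) (lattice v w) i) := measure_iUnion_le _
    _ = _ := by simp_rw [volume_translates]

/-- The lattice arrangement of a bounded set has the density area / determinant. -/
theorem hasDensity_translates {K : Set (ℝ × ℝ)} (hb : Bornology.IsBounded K) (hne : K.Nonempty)
    {v w : ℝ × ℝ} (h : cross v w ≠ 0) :
    HasDensity (translates K (lattice v w)) (volume K / ENNReal.ofReal |cross v w|) := by
  obtain ⟨R, hR, hs⟩ := exists_subset_disc (hb.union (isBounded_cell v w))
  obtain ⟨hK, hc⟩ := union_subset_iff.1 hs
  set D := ENNReal.ofReal |cross v w| with hD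
  have hD0 : D ≠ 0 := by simpa [hD] using h
  have hDt : D ≠ ∞ := ENNReal.ofReal_ne_top
  have hvK : volume K / D ≠ ∞ := ENNReal.div_ne_top hb.measure_lt_top.ne hD0
  have key : ∀ N : ℝ≥0∞, N * volume K = volume K / D * (N * D) := fun N => by
    rw [ENNReal.div_eq_inv_mul, mul_comm N D, ← mul_assoc, mul_assoc _ _ D, mul_comm (volume K) D,
      ← mul_assoc, ENNReal.inv_mul_cancel hD0 hDt, one_mul, mul_comm]
  have lim : ∀ c : ℝ, Tendsto (fun r : ℝ => volume K / D * volume (disc (r + c)) /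
      volume (disc r)) atTop (𝓝 (volume K / D)) := fun c => by
    simpa [mul_div_assoc] using
      ENNReal.Tendsto.const_mul (tendsto_volume_disc_add_div c) (Or.inr hvK)
  have up : ∀ r : ℝ, (∑' i : {i // (translates K (lattice v w) i ∩ disc r).Nonempty},
      volume (translates K (lattice v w) i)) / volume (disc r) ≤
      volume K / D * volume (disc (r + 2 * R)) / volume (disc r) := fun r => by
    simp_rw [volume_translates]
    rw [ENNReal.tsum_const, key]
    gcongr
    exact card_meeting_mul_le h hK hc r
  have lo : ∀ r : ℝ, volume K / D * volume (disc (r + -(2 * R))) / volume (disc r) ≤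
      (∑' i : {i // translates K (lattice v w) i ⊆ disc r},
      volume (translates K (lattice v w) i)) / volume (disc r) := fun r => by
    simp_rw [volume_translates]
    rw [ENNReal.tsum_const, key]
    gcongr
    exact le_card_contained_mul h hK hc r
  have mid : ∀ r : ℝ, (∑' i : {i // translates K (lattice v w) i ⊆ disc r},
      volume (translates K (lattice v w) i)) / volume (disc r) ≤
      (∑' i : {i // (translates K (lattice v w) i ∩ disc r).Nonempty},
      volume (translates K (lattice v w) i)) / volume (disc r) := fun r => by
    gcongr
    -- A translate contained in the disc also meets it, because `K` is nonempty.
    refine ENNReal.tsum_mono_subtype (fun i => volume (translates K (lattice v w) i))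
      (s := {i | translates K (lattice v w) i ⊆ disc r})
      (t := {i | (translates K (lattice v w) i ∩ disc r).Nonempty}) fun i hi => ?_
    rw [mem_ofPred_eq, inter_eq_left.2 hi]
    exact hne.image _
  exact ⟨(tendsto_of_tendsto_of_tendsto_of_le_of_le (lim _) (lim _)
      (fun r => (lo r).trans (mid r)) up).limsup_eq,
    (tendsto_of_tendsto_of_tendsto_of_le_of_le (lim _) (lim _) lo
      (fun r => (mid r).trans (up r))).liminf_eq⟩

/-! ### Packings by translates of the region. -/

theorem isPacking_translates_iff {K : Set (ℝ × ℝ)} {Λ : Submodule ℤ (ℝ × ℝ)} :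
    IsPacking (translates K Λ) ↔
      ∀ u ∈ Λ, u ≠ 0 → ∀ p ∈ interior K, p + u ∉ interior K := by
  have hint : ∀ i : Λ, interior (translates K Λ i) = (fun p => p + (i : ℝ × ℝ)) '' interior K :=
    fun i => ((Homeomorph.addRight (i : ℝ × ℝ)).image_interior K).symm
  constructor
  · intro h u hu hu0 p hp hpu
    have : Disjoint (interior (translates K Λ ⟨u, hu⟩)) (interior (translates K Λ 0)) :=
      h fun e => hu0 (congrArg Subtype.val e)
    rw [hint, hint, Set.disjoint_left] at this
    exact this ⟨p, hp, rfl⟩ ⟨p + u, hpu, by simp⟩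
  · intro h i j hij
    rw [hint, hint, Set.disjoint_left]
    rintro _ ⟨p, hp, rfl⟩ ⟨q, hq, he⟩
    refine h (i - j : ℝ × ℝ) (Λ.sub_mem i.2 j.2) (fun e => hij (Subtype.ext (sub_eq_zero.1 e)))
      p hp ?_
    have he : q + (j : ℝ × ℝ) = p + i := he
    rwa [← add_sub_assoc, ← he, add_sub_cancel_right]

theorem one_sub_le_of_concaveOn {f : ℝ → ℝ} (hconc : ConcaveOn ℝ (Icc 0 1) f) (h0 : f 0 = 1)
    (h1 : 0 ≤ f 1) {x : ℝ} (hx : x ∈ Icc (0 : ℝ) 1) : 1 - x ≤ f x := by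
  have := hconc.2 (left_mem_Icc.2 zero_le_one) (right_mem_Icc.2 zero_le_one)
    (sub_nonneg.2 hx.2) hx.1 (sub_add_cancel 1 x)
  simp only [smul_eq_mul, mul_zero, mul_one, zero_add, h0] at this
  nlinarith [mul_nonneg hx.1 h1]

theorem region_subset_square {f : ℝ → ℝ} (hanti : AntitoneOn f (Icc 0 1)) (h0 : f 0 = 1) :
    region f ⊆ Icc 0 1 ×ˢ Icc 0 1 := fun _ ⟨h1, h2, h3, h4⟩ =>
  ⟨⟨h1, h2⟩, h3, h4.trans (h0 ▸ hanti (left_mem_Icc.2 zero_le_one) ⟨h1, h2⟩ h1)⟩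

theorem interior_region_subset {f : ℝ → ℝ} (hanti : AntitoneOn f (Icc 0 1)) (h0 : f 0 = 1)
    {p : ℝ × ℝ} (hp : p ∈ interior (region f)) :
    (0 < p.1 ∧ p.1 < 1) ∧ (0 < p.2 ∧ p.2 < 1) ∧ p.2 < f p.1 := by
  have h := interior_mono (region_subset_square hanti h0) hp
  rw [interior_prod_eq, interior_Icc] at h
  refine ⟨h.1, h.2, ?_⟩
  have hc : Tendsto (fun ε : ℝ => (p.1, p.2 + ε)) (𝓝[>] 0) (𝓝 p) := by
    have : Continuous fun ε : ℝ => (p.1, p.2 + ε) := by fun_prop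
    simpa using (this.tendsto 0).mono_left nhdsWithin_le_nhds
  obtain ⟨ε, hε, h⟩ := ((hc.eventually_mem (mem_interior_iff_mem_nhds.1 hp)).and
    self_mem_nhdsWithin).exists
  have h1 : p.2 + ε ≤ f p.1 := hε.2.2.2
  have h2 : 0 < ε := h
  linarith

theorem mem_interior_region {f : ℝ → ℝ} (hcont : ContinuousOn f (Icc 0 1)) {p : ℝ × ℝ}
    (h1 : 0 < p.1) (h2 : p.1 < 1) (h3 : 0 < p.2) (h4 : p.2 < f p.1) :
    p ∈ interior (region f) := by
  rw [mem_interior_iff_mem_nhds]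
  have hf : ContinuousAt (fun q : ℝ × ℝ => f q.1) p :=
    ContinuousAt.comp (f := Prod.fst) (hcont.continuousAt (Icc_mem_nhds h1 h2)) continuousAt_fst
  filter_upwards [continuousAt_fst.eventually_const_lt h1, continuousAt_fst.eventually_lt_const h2,
    continuousAt_snd.eventually_const_lt h3, continuousAt_snd.eventually_lt hf h4]
    with q a b c d using ⟨a.le, b.le, c.le, d.le⟩

/-- No nonzero vector of `Λ` in the right half-plane is interior to the difference body of
`region f`. -/
def Admissible (f : ℝ → ℝ) (Λ : Submodule ℤ (ℝ × ℝ)) : Prop :=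
  ∀ u ∈ Λ, u ≠ 0 → 0 ≤ u.1 → u.1 < 1 → (0 ≤ u.2 → f u.1 ≤ u.2) ∧ (u.2 ≤ 0 → u.2 ≤ -1)

/-- A point under the graph may lie on an axis; a small diagonal shift moves it into the interior.
Two such points shifted by the same `ε` keep their difference. -/
theorem eventually_corner {f : ℝ → ℝ} (hcont : ContinuousOn f (Icc 0 1)) {a b : ℝ} (ha : 0 ≤ a)
    (ha1 : a < 1) (hb : 0 ≤ b) (hab : b < f a) :
    ∀ᶠ ε in 𝓝[>] (0 : ℝ), (a + ε, b + ε) ∈ interior (region f) := by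
  have ht : Tendsto (fun ε => a + ε) (𝓝[>] 0) (𝓝 a) := by
    simpa using ((continuous_const_add a).tendsto 0).mono_left nhdsWithin_le_nhds
  have ht' : Tendsto (fun ε => b + ε) (𝓝[>] 0) (𝓝 b) := by
    simpa using ((continuous_const_add b).tendsto 0).mono_left nhdsWithin_le_nhds
  have hlt := ht.eventually_lt_const ha1
  have hpos : ∀ᶠ ε in 𝓝[>] (0 : ℝ), 0 < ε := self_mem_nhdsWithin
  have hw : Tendsto (fun ε => a + ε) (𝓝[>] 0) (𝓝[Icc 0 1] a) :=
    tendsto_nhdsWithin_iff.2 ⟨ht, by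
      filter_upwards [hlt, hpos] with ε h1 h2 using ⟨by positivity, h1.le⟩⟩
  have hf := (hcont a ⟨ha, ha1.le⟩).tendsto.comp hw
  filter_upwards [hlt, hpos, ht'.eventually_lt hf hab] with ε h1 h2 h3
  exact mem_interior_region hcont (show 0 < a + ε by positivity) h1
    (show 0 < b + ε by positivity) h3

/-- A forbidden vector `(a, b)` is a difference of two points under the graph: `(a, b) - (0, 0)` if
`b ≥ 0`, and `(a, 0) - (0, -b)` if `b ≤ 0`. -/
theorem admissible_of_isPacking {f : ℝ → ℝ} (hcont : ContinuousOn f (Icc 0 1))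
    (hlow : ∀ x ∈ Icc (0 : ℝ) 1, 1 - x ≤ f x) (h0 : f 0 = 1) {Λ : Submodule ℤ (ℝ × ℝ)}
    (h : IsPacking (translates (region f) Λ)) : Admissible f Λ := by
  rw [isPacking_translates_iff] at h
  rintro ⟨a, b⟩ hu hu0 (ha : 0 ≤ a) (ha1 : a < 1)
  constructor
  · intro (hb : 0 ≤ b)
    by_contra! hlt
    have hlt : b < f a := hlt
    obtain ⟨ε, h1, h2⟩ := ((eventually_corner hcont ha ha1 hb hlt).and
      (eventually_corner hcont le_rfl zero_lt_one le_rfl (h0 ▸ zero_lt_one))).exists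
    refine h _ hu hu0 _ h2 ?_
    simpa [add_comm] using h1
  · intro (hb : b ≤ 0)
    by_contra! hlt
    have hlt : -1 < b := hlt
    have hfa : 0 < f a := (sub_pos.2 ha1).trans_le (hlow a ⟨ha, ha1.le⟩)
    obtain ⟨ε, h1, h2⟩ := ((eventually_corner hcont ha ha1 le_rfl hfa).and
      (eventually_corner hcont le_rfl zero_lt_one (neg_nonneg.2 hb) (by linarith : -b < f 0))).exists
    refine h _ hu hu0 _ h2 ?_
    simpa [add_comm] using h1

/-- The stair polygons at `x` tile the plane, and they contain the translates of the region. -/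
theorem isPacking_stairLattice {f : ℝ → ℝ} (hanti : AntitoneOn f (Icc 0 1)) (h0 : f 0 = 1)
    {x : ℝ} (hx : x ∈ Icc (0 : ℝ) 1) (hfx : 0 ≤ f x) :
    IsPacking (translates (region f) (lattice (x - 1, 1) (x, f x))) := by
  rw [isPacking_translates_iff]
  intro u hu hu0 p hp hpu
  obtain ⟨k, l, rfl⟩ := mem_lattice.1 hu
  obtain ⟨⟨hp1, hp1'⟩, ⟨hp2, hp2'⟩, hp3⟩ := interior_region_subset hanti h0 hp
  obtain ⟨⟨hq1, hq1'⟩, ⟨hq2, hq2'⟩, hq3⟩ := interior_region_subset hanti h0 hpu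
  have e1 : (k • (x - 1, 1) + l • (x, f x)).1 = k * (x - 1) + l * x := by simp
  have e2 : (k • (x - 1, 1) + l • (x, f x)).2 = k + l * f x := by simp
  have hne : ¬(k = 0 ∧ l = 0) := fun ⟨hk, hl⟩ => hu0 (by rw [hk, hl, zero_smul, zero_smul, add_zero])
  rw [Prod.fst_add, e1] at hq1 hq1' hq3
  rw [Prod.snd_add, e2] at hq2 hq2' hq3
  -- By monotonicity the interior of the region lies in the stair polygon. This decides the case `k
  -- = 0`, where a translation by `l (x, f x)` with `l ≥ 1` leaves the polygon. In the other cases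
  -- one coordinate of the translation is at least 1 in absolute value, which the unit square rules
  -- out.
  have hbound : ∀ {a b : ℝ}, 0 < a → a < 1 → b < f a → a < x ∨ b < f x := fun {a b} h1 h2 h3 =>
    (lt_or_ge a x).imp_right fun h => h3.trans_le (hanti hx ⟨h1.le, h2.le⟩ h)
  have hpx := hbound hp1 hp1' hp3
  have hqx := hbound hq1 hq1' hq3
  obtain ⟨hx0, hx1⟩ := hx
  rcases lt_trichotomy l 0 with hl | rfl | hl
  · have hl' : (l : ℝ) ≤ -1 := by exact_mod_cast (show l ≤ -1 by omega)
    rcases lt_trichotomy k 0 with hk | rfl | hk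
    · have hk' : (k : ℝ) ≤ -1 := by exact_mod_cast (show k ≤ -1 by omega)
      nlinarith
    · simp only [Int.cast_zero, zero_mul, zero_add] at hq1 hq1' hq2 hq2' hqx
      rcases hpx with h | h <;> nlinarith
    · have hk' : (1 : ℝ) ≤ k := by exact_mod_cast hk
      nlinarith
  · rcases lt_trichotomy k 0 with hk | rfl | hk
    · have hk' : (k : ℝ) ≤ -1 := by exact_mod_cast (show k ≤ -1 by omega)
      simp only [Int.cast_zero, zero_mul, add_zero] at hq2 hq2'
      linarith
    · exact absurd ⟨rfl, rfl⟩ hne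
    · have hk' : (1 : ℝ) ≤ k := by exact_mod_cast hk
      simp only [Int.cast_zero, zero_mul, add_zero] at hq2 hq2'
      linarith
  · have hl' : (1 : ℝ) ≤ l := by exact_mod_cast hl
    rcases lt_trichotomy k 0 with hk | rfl | hk
    · have hk' : (k : ℝ) ≤ -1 := by exact_mod_cast (show k ≤ -1 by omega)
      nlinarith
    · simp only [Int.cast_zero, zero_mul, zero_add] at hq1 hq1' hq2 hq2' hqx
      rcases hqx with h | h <;> nlinarith
    · have hk' : (1 : ℝ) ≤ k := by exact_mod_cast hk
      nlinarith

/-! ### Bases of planar lattices. -/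

theorem cross_zsmul_add (v w : ℝ × ℝ) (k l m n : ℤ) :
    cross (k • v + l • w) (m • v + n • w) = ((k * n - l * m : ℤ) : ℝ) * cross v w := by
  simp [cross]
  ring

theorem lattice_eq_of_abs_cross_eq {v w p q : ℝ × ℝ} (h : cross v w ≠ 0) (hp : p ∈ lattice v w)
    (hq : q ∈ lattice v w) (he : |cross p q| = |cross v w|) : lattice p q = lattice v w := by
  obtain ⟨k, l, rfl⟩ := mem_lattice.1 hp
  obtain ⟨m, n, rfl⟩ := mem_lattice.1 hq
  rw [cross_zsmul_add, abs_mul] at he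
  have h1 : |(k * n - l * m : ℤ)| = 1 := by
    have := mul_right_cancel₀ (abs_pos.2 h).ne' (he.trans (one_mul _).symm)
    exact_mod_cast this
  have h2 : (k * n - l * m) * (k * n - l * m) = 1 := by
    rw [← abs_mul_abs_self, h1, one_mul]
  refine le_antisymm (Submodule.span_le.2 ?_) (Submodule.span_le.2 ?_)
  · rintro _ (rfl | rfl)
    exacts [hp, hq]
  -- The change of basis has determinant `d = ±1`, so its inverse is `d` times the adjugate.
  · generalize hd : k * n - l * m = d at h2
    intro y hy
    rcases hy with hy | hy <;> rw [hy, SetLike.mem_coe]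
    · refine mem_lattice.2 ⟨d * n, -(d * l), ?_⟩
      calc _ = (d * (k * n - l * m)) • v + (0 : ℤ) • w := by module
        _ = v := by rw [hd, h2]; simp
    · refine mem_lattice.2 ⟨-(d * m), d * k, ?_⟩
      calc _ = (0 : ℤ) • v + (d * (k * n - l * m)) • w := by module
        _ = w := by rw [hd, h2]; simp

theorem finite_lattice_inter {v w : ℝ × ℝ} (h : cross v w ≠ 0) {s : Set (ℝ × ℝ)}
    (hs : Bornology.IsBounded s) : (s ∩ (lattice v w : Set (ℝ × ℝ))).Finite := by
  let b := basisOfLinearIndependentOfCardEqFinrank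
    (linearIndependent_pair_iff_cross_ne_zero.2 h) (by simp)
  have hb : lattice v w = Submodule.span ℤ (range b) := by
    rw [coe_basisOfLinearIndependentOfCardEqFinrank, Matrix.range_cons, Matrix.range_cons,
      Matrix.range_empty, union_empty]
    rfl
  rw [hb]
  exact ZSpan.setFinite_inter b hs

theorem exists_mem_lattice_abs_fst_lt_one {v w : ℝ × ℝ} (h : cross v w ≠ 0) :
    ∃ u ∈ lattice v w, u ≠ 0 ∧ |u.1| < 1 := by
  by_cases hw : w.1 = 0
  · refine ⟨w, mem_lattice.2 ⟨0, 1, by simp⟩, ?_, by simp [hw]⟩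
    rintro rfl
    simp [cross] at h
  · obtain ⟨n, hn⟩ := exists_nat_gt |w.1|
    have hn0 : 0 < n := by exact_mod_cast (abs_nonneg _).trans_lt hn
    -- Dirichlet approximation of `v.1 / w.1`, with error below `1 / |w.1|`.
    obtain ⟨j, k, hk, -, hjk⟩ := Real.exists_int_int_abs_mul_sub_le (v.1 / w.1) hn0
    refine ⟨k • v + (-j) • w, mem_lattice.2 ⟨_, _, rfl⟩, fun h0 => ?_, ?_⟩
    · have h2 := cross_zsmul_add v w k (-j) 0 1
      rw [h0] at h2
      simp only [cross, Prod.fst_zero, Prod.snd_zero, zero_mul, sub_zero, mul_zero, mul_one,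
        zero_eq_mul, Int.cast_eq_zero] at h2
      exact h2.elim hk.ne' h
    · have e : (k • v + (-j) • w).1 = w.1 * (k * (v.1 / w.1) - j) := by
        simp
        field_simp
        ring
      rw [e, abs_mul]
      calc _ ≤ |w.1| * (1 / (n + 1)) := by gcongr
        _ < 1 := by rw [mul_one_div, div_lt_one (by positivity)]; linarith

theorem exists_lowest_in_strip {v w : ℝ × ℝ} (h : cross v w ≠ 0) :
    ∃ p ∈ lattice v w, p ≠ 0 ∧ |p.1| < 1 ∧ 0 ≤ p.2 ∧
      ∀ u ∈ lattice v w, u ≠ 0 → |u.1| < 1 → p.2 ≤ |u.2| := by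
  obtain ⟨u₀, hu₀, hu₀', hlt⟩ := exists_mem_lattice_abs_fst_lt_one h
  have hfin : {u | u ∈ lattice v w ∧ u ≠ 0 ∧ |u.1| < 1 ∧ |u.2| ≤ |u₀.2|}.Finite := by
    refine (finite_lattice_inter h (Metric.isBounded_closedBall (x := (0 : ℝ × ℝ))
      (r := max 1 |u₀.2|))).subset ?_
    rintro u ⟨h1, -, h3, h4⟩
    refine ⟨?_, h1⟩
    rw [mem_closedBall_zero_iff, Prod.norm_def]
    exact max_le_max h3.le h4
  obtain ⟨p, ⟨hp, hp0, hp1⟩, hmin⟩ := hfin.exists_minimalFor (fun u => |u.2|) _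
    ⟨u₀, hu₀, hu₀', hlt, le_rfl⟩
  have hmin : ∀ u ∈ lattice v w, u ≠ 0 → |u.1| < 1 → |p.2| ≤ |u.2| := by
    intro u h1 h2 h3
    by_contra! h4
    exact (hmin ⟨h1, h2, h3, h4.le.trans hp1.2⟩ h4.le).not_gt h4
  rcases le_total 0 p.2 with h2 | h2
  · exact ⟨p, hp, hp0, hp1.1, h2, by rwa [abs_of_nonneg h2] at hmin⟩
  · exact ⟨-p, neg_mem hp, neg_ne_zero.2 hp0, by simpa using hp1.1, by simpa using h2,
      by rwa [abs_of_nonpos h2] at hmin⟩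

/-- Take for `p` a lowest nonzero vector of the strip `|x| < 1`. It is primitive, since otherwise a
proper divisor would be lower; so it extends to a basis. Reducing the second vector modulo `p` makes
it lower than `p`, and minimality then pushes it out of the strip. -/
theorem exists_reduced_basis {v w : ℝ × ℝ} (h : cross v w ≠ 0)
    (hstrip : ∀ u ∈ lattice v w, u ≠ 0 → |u.1| < 1 → u.2 ≠ 0) :
    ∃ p ∈ lattice v w, ∃ q ∈ lattice v w, |cross p q| = |cross v w| ∧ |p.1| < 1 ∧ 0 < p.2 ∧
      1 ≤ q.1 ∧ |q.2| < p.2 := by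
  obtain ⟨p, hp, hp0, hp1, hp2, hmin⟩ := exists_lowest_in_strip h
  have hp2 : 0 < p.2 := hp2.lt_of_ne' (hstrip p hp hp0 hp1)
  obtain ⟨k, l, hkl⟩ := mem_lattice.1 hp
  have hg : IsCoprime k l := by
    rw [Int.isCoprime_iff_gcd_eq_one]
    obtain ⟨k', hk'⟩ := Int.gcd_dvd_left k l
    obtain ⟨l', hl'⟩ := Int.gcd_dvd_right k l
    generalize Int.gcd k l = g at hk' hl'
    have hpg : p = (g : ℤ) • (k' • v + l' • w) := by
      rw [← hkl, smul_add, smul_smul, smul_smul, ← hk', ← hl']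
    have hu0 : k' • v + l' • w ≠ 0 := fun e => hp0 (by rw [hpg, e, smul_zero])
    generalize hu : k' • v + l' • w = u at hpg hu0
    have e1 : p.1 = g * u.1 := by simp [hpg]
    have e2 : p.2 = g * u.2 := by simp [hpg]
    have hgp : 1 ≤ g := Nat.one_le_iff_ne_zero.2 fun e => hp2.ne' (by simp [e2, e])
    have hgr : (1 : ℝ) ≤ g := by exact_mod_cast hgp
    have hu2 : 0 < u.2 := by
      rw [e2] at hp2
      exact pos_of_mul_pos_right hp2 (by positivity)
    have hu1 : |u.1| < 1 := by
      rw [e1, abs_mul, Nat.abs_cast] at hp1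
      nlinarith [abs_nonneg u.1]
    have := hmin u (mem_lattice.2 ⟨_, _, hu⟩) hu0 hu1
    rw [e2, abs_of_pos hu2] at this
    have : (g : ℝ) ≤ 1 := by nlinarith
    exact le_antisymm (by exact_mod_cast this) hgp
  obtain ⟨a, b, hab⟩ := hg
  set n := round ((-b * v.2 + a * w.2) / p.2) with hn
  obtain ⟨q, hq, hcross, hq2⟩ : ∃ q ∈ lattice v w, cross p q = cross v w ∧ |q.2| < p.2 := by
    refine ⟨(-b - n * k) • v + (a - n * l) • w, mem_lattice.2 ⟨_, _, rfl⟩, ?_, ?_⟩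
    · rw [← hkl, cross_zsmul_add, show k * (a - n * l) - l * (-b - n * k) = 1 by
        linear_combination hab]
      simp
    · have e : ((-b - n * k) • v + (a - n * l) • w).2 =
          ((-b * v.2 + a * w.2) / p.2 - n) * p.2 := by
        rw [sub_mul, div_mul_cancel₀ _ hp2.ne', ← hkl]
        simp
        ring
      rw [e, abs_mul, abs_of_pos hp2]
      nlinarith [abs_sub_round ((-b * v.2 + a * w.2) / p.2)]
  have hq0 : q ≠ 0 := by
    rintro rfl
    exact h (by rw [← hcross]; simp [cross])
  have hq1 : 1 ≤ |q.1| := by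
    by_contra! hlt
    exact (hmin q hq hq0 hlt).not_gt hq2
  rcases le_total 0 q.1 with h0 | h0
  · exact ⟨p, hp, q, hq, by rw [hcross], hp1, hp2, by rwa [abs_of_nonneg h0] at hq1, hq2⟩
  · refine ⟨p, hp, -q, neg_mem hq, ?_, hp1, hp2, by rwa [abs_of_nonpos h0] at hq1, by simpa⟩
    rw [← hcross, ← abs_neg]
    congr 1
    simp [cross]
    ring

/-! ### Generators of an admissible lattice. -/

/-- A lattice that is admissible for `f` has determinant at least one, or it is generated by a
vector `(c, d)` above the graph of `f` and a vector `(-a, b)` with `1 - c ≤ a` and `1 ≤ b`. -/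
theorem Admissible.exists_generators {f : ℝ → ℝ} {v w : ℝ × ℝ} (h : cross v w ≠ 0)
    (hadm : Admissible f (lattice v w)) :
    1 ≤ |cross v w| ∨ ∃ a b c d : ℝ, (0 < c ∧ c < 1) ∧ 1 - c ≤ a ∧ 1 ≤ b ∧ f c ≤ d ∧
      lattice v w = lattice (-a, b) (c, d) ∧ |cross v w| = c * b + a * d := by
  have hstrip : ∀ u ∈ lattice v w, u ≠ 0 → |u.1| < 1 → u.2 ≠ 0 := by
    have aux : ∀ u ∈ lattice v w, u ≠ 0 → |u.1| < 1 → 0 ≤ u.1 → u.2 ≠ 0 := by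
      intro u hu hu0 hlt h1 h2
      have := (hadm u hu hu0 h1 (lt_of_abs_lt hlt)).2 h2.le
      linarith
    intro u hu hu0 hlt
    rcases le_total 0 u.1 with h1 | h1
    · exact aux u hu hu0 hlt h1
    · simpa using aux (-u) (neg_mem hu) (neg_ne_zero.2 hu0) (by simpa using hlt) (by simpa using h1)
  obtain ⟨p, hp, q, hq, hD, hp1, hp2, hq1, hq2⟩ := exists_reduced_basis h hstrip
  obtain ⟨p1, p2⟩ := p
  obtain ⟨q1, q2⟩ := q
  simp only [abs_lt] at hp1 hp2 hq1 hq2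
  have key : ∀ a b c d : ℝ, (-a, b) ∈ lattice v w → (c, d) ∈ lattice v w → 0 ≤ a → 0 < b →
      0 ≤ c → 0 < d → |cross v w| = c * b + a * d →
      lattice v w = lattice (-a, b) (c, d) := by
    intro a b c d hu hv ha hb hc hd he
    refine (lattice_eq_of_abs_cross_eq h hu hv ?_).symm
    rw [he, ← abs_neg, abs_of_nonneg]
    · simp [cross]
      ring
    · have : 0 ≤ c * b + a * d := by positivity
      simp only [cross]
      linarith
  -- If `p` leans to the left, it serves as `(-a, b)`, and `p + q` as `(c, d)` unless the
  -- determinant is at least 1. If `p` leans to the right, it serves as `(c, d)`, and `k p - q` as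
  -- `(-a, b)`.
  rcases le_or_gt p1 0 with h1 | h1
  · have hb : 1 ≤ p2 := by
      have := (hadm (-(p1, p2)) (neg_mem hp) (fun e => hp2.ne' (by simpa using congrArg Prod.snd e))
        (by simpa using h1) (by simpa using by linarith)).2 (by simpa using hp2.le)
      simpa using this
    have hD' : |cross v w| = p2 * q1 - p1 * q2 := by
      rw [← hD, ← abs_neg, abs_of_nonneg]
      · simp [cross]
      · simp only [cross]
        nlinarith
    rcases le_or_gt 0 q2 with h2 | h2
    · left
      nlinarith
    rcases le_or_gt 1 (p1 + q1) with h3 | h3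
    · left
      nlinarith
    right
    have hv : (p1 + q1, p2 + q2) ∈ lattice v w := add_mem hp hq
    have hd := (hadm _ hv (fun e => by have := congrArg Prod.snd e; simp at this; linarith)
      (by simp; linarith) h3).1 (by simp; linarith)
    have hu : (- -p1, p2) ∈ lattice v w := by simpa using hp
    exact ⟨-p1, p2, p1 + q1, p2 + q2, ⟨by linarith, h3⟩, by linarith, hb, hd,
      key _ _ _ _ hu hv (by linarith) hp2 (by linarith) (by linarith) (by rw [hD']; ring),
      by rw [hD']; ring⟩
  · right
    have hd : f p1 ≤ p2 := (hadm _ hp (fun e => hp2.ne' (by simpa using congrArg Prod.snd e))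
      h1.le hp1.2).1 hp2.le
    -- The least `k` with `q1 - k * p1 < 1`; leastness gives `1 - p1 ≤ q1 - k * p1`.
    set k := ⌊(q1 - 1) / p1⌋ + 1 with hk
    have hk1 : 1 ≤ k := by
      have : 0 ≤ ⌊(q1 - 1) / p1⌋ := Int.floor_nonneg.2 (div_nonneg (by linarith) h1.le)
      omega
    have hkr : (1 : ℝ) ≤ k := by exact_mod_cast hk1
    have hlo : q1 - 1 < k * p1 := by
      rw [← div_lt_iff₀ h1, hk]
      push_cast
      exact Int.lt_floor_add_one _
    have hhi : (k - 1) * p1 ≤ q1 - 1 := by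
      rw [← le_div_iff₀ h1, hk]
      push_cast
      rw [add_sub_cancel_right]
      exact Int.floor_le _
    have hbpos : 0 < k * p2 - q2 := by nlinarith
    have hu : (-(q1 - k * p1), k * p2 - q2) ∈ lattice v w := by
      have : (-(q1 - k * p1), k * p2 - q2) = k • (p1, p2) - (q1, q2) := by
        ext <;> simp
      rw [this]
      exact sub_mem (Submodule.smul_mem _ _ hp) hq
    have hb : 1 ≤ k * p2 - q2 := by
      have := (hadm _ (neg_mem hu) (fun e => by
        have := congrArg Prod.snd e
        simp at this
        linarith) (by simp; linarith) (by simp; linarith)).2 (by simp; linarith)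
      simp at this
      linarith
    have hD' : |cross v w| = p1 * (k * p2 - q2) + (q1 - k * p1) * p2 := by
      rw [← hD, ← abs_neg, abs_of_nonneg]
      · simp [cross]
        ring
      · simp only [cross]
        nlinarith
    exact ⟨q1 - k * p1, k * p2 - q2, p1, p2, ⟨h1, hp1.2⟩, by linarith, hb, hd,
      key _ _ _ _ hu hp (by linarith) hbpos h1.le hp2 hD', hD'⟩

/-! ### Areas of stair polygons and the minimal determinant. -/

/-- The area of the stair polygon at `x`. -/
def stairArea (f : ℝ → ℝ) (x : ℝ) : ℝ := x + f x - x * f x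

theorem stairArea_nonneg {f : ℝ → ℝ} {x : ℝ} (hx : x ∈ Icc (0 : ℝ) 1) (hf : 0 ≤ f x) :
    0 ≤ stairArea f x := by
  unfold stairArea
  nlinarith [hx.1, mul_nonneg (sub_nonneg.2 hx.2) hf]

theorem volume_stair {f : ℝ → ℝ} {x : ℝ} (hx : x ∈ Icc (0 : ℝ) 1) (h0 : 0 ≤ f x) (h1 : f x ≤ 1) :
    volume (stair f x) = ENNReal.ofReal (stairArea f x) := by
  have e : stair f x = Icc 0 x ×ˢ Icc 0 1 ∪ Ioc x 1 ×ˢ Icc 0 (f x) := by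
    ext p
    simp only [stair, mem_union, mem_prod, mem_Icc, mem_Ioc]
    constructor
    · rintro (h | ⟨h2, h3⟩)
      · exact Or.inl h
      · rcases le_or_gt p.1 x with h | h
        · exact Or.inl ⟨⟨h2.1, h⟩, h3.1, h3.2.trans h1⟩
        · exact Or.inr ⟨⟨h, h2.2⟩, h3⟩
    · rintro (h | ⟨h2, h3⟩)
      · exact Or.inl h
      · exact Or.inr ⟨⟨hx.1.trans h2.1.le, h2.2⟩, h3⟩
  have hd : Disjoint (Icc 0 x ×ˢ Icc 0 1 : Set (ℝ × ℝ)) (Ioc x 1 ×ˢ Icc 0 (f x)) :=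
    Set.disjoint_left.2 fun p hp hq => hq.1.1.not_ge hp.1.2
  rw [e, measure_union hd (measurableSet_Ioc.prod measurableSet_Icc), Measure.volume_eq_prod,
    Measure.prod_prod, Measure.prod_prod, Real.volume_Icc, Real.volume_Icc, Real.volume_Ioc,
    Real.volume_Icc, ← ENNReal.ofReal_mul (by linarith [hx.1]),
    ← ENNReal.ofReal_mul (by linarith [hx.2]),
    ← ENNReal.ofReal_add (by linarith [hx.1]) (mul_nonneg (by linarith [hx.2]) (by linarith))]
  congr 1
  unfold stairArea
  ring

theorem mem_minimizers_iff {f : ℝ → ℝ} (hf : ∀ x ∈ Icc (0 : ℝ) 1, 0 ≤ f x ∧ f x ≤ 1) {x : ℝ} :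
    x ∈ minimizers f ↔
      x ∈ Icc (0 : ℝ) 1 ∧ ∀ t ∈ Icc (0 : ℝ) 1, stairArea f x ≤ stairArea f t := by
  refine and_congr_right fun hx => forall₂_congr fun t ht => ?_
  rw [volume_stair hx (hf x hx).1 (hf x hx).2, volume_stair ht (hf t ht).1 (hf t ht).2,
    ENNReal.ofReal_le_ofReal_iff (stairArea_nonneg ht (hf t ht).1)]

theorem abs_cross_stairLattice {f : ℝ → ℝ} {x : ℝ} (hx : x ∈ Icc (0 : ℝ) 1) (hf : 0 ≤ f x) :
    |cross (x - 1, 1) (x, f x)| = stairArea f x := by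
  rw [← abs_neg, ← abs_of_nonneg (stairArea_nonneg hx hf)]
  congr 1
  simp only [cross, stairArea]
  ring

theorem exists_stairArea_lt_one {f : ℝ → ℝ} (hcont : ContinuousOn f (Icc 0 1))
    (hanti : AntitoneOn f (Icc 0 1)) (h0 : f 0 = 1)
    (hsq : region f ≠ Icc (0 : ℝ) 1 ×ˢ Icc (0 : ℝ) 1) :
    ∃ t ∈ Icc (0 : ℝ) 1, stairArea f t < 1 := by
  have h1 : f 1 < 1 := by
    by_contra! h
    refine hsq ((region_subset_square hanti h0).antisymm ?_)
    rintro p ⟨⟨h1, h2⟩, h3, h4⟩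
    exact ⟨h1, h2, h3, (h4.trans h).trans (hanti ⟨h1, h2⟩ (right_mem_Icc.2 zero_le_one) h2)⟩
  have hev : ∀ᶠ t in 𝓝[Iio 1] (1 : ℝ), f t < 1 := by
    have := (hcont 1 (right_mem_Icc.2 zero_le_one)).mono Ico_subset_Icc_self
    rw [ContinuousWithinAt, nhdsWithin_Ico_eq_nhdsLT zero_lt_one] at this
    exact this.eventually_lt_const h1
  obtain ⟨t, ht, ht0, ht1⟩ := (hev.and (Ioo_mem_nhdsLT zero_lt_one)).exists
  refine ⟨t, ⟨ht0.le, ht1.le⟩, ?_⟩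
  unfold stairArea
  -- Here `1 - stairArea f t = (1 - t) * (1 - f t)`, and both factors are positive.
  nlinarith

/-- The determinant of an admissible lattice is at least the minimal area of a stair polygon,
and in the case of equality the lattice comes from a stair polygon. -/
theorem Admissible.le_abs_cross {f : ℝ → ℝ} {v w : ℝ × ℝ} (h : cross v w ≠ 0)
    (hadm : Admissible f (lattice v w)) (hpos : ∀ x, 0 ≤ x → x < 1 → 0 < f x) {m : ℝ} (hm : m < 1)
    (hmin : ∀ t ∈ Icc (0 : ℝ) 1, m ≤ stairArea f t) :
    m ≤ |cross v w| ∧ (|cross v w| = m → ∃ x ∈ Icc (0 : ℝ) 1, stairArea f x = m ∧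
      lattice v w = lattice (x - 1, 1) (x, f x)) := by
  rcases hadm.exists_generators h with h1 | ⟨a, b, c, d, ⟨hc0, hc1⟩, ha, hb, hd, hΛ, hD⟩
  · exact ⟨hm.le.trans h1, fun e => absurd (e ▸ h1) hm.not_ge⟩
  · have hc : c ∈ Icc (0 : ℝ) 1 := ⟨hc0.le, hc1.le⟩
    have hmc := hmin c hc
    have hd0 : 0 < d := (hpos c hc0.le hc1).trans_le hd
    have p1 : 0 ≤ c * (b - 1) := mul_nonneg hc0.le (by linarith)
    have p2 : 0 ≤ (a - (1 - c)) * d := mul_nonneg (by linarith) hd0.le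
    have p3 : 0 ≤ (1 - c) * (d - f c) := mul_nonneg (by linarith) (by linarith)
    have e : |cross v w| = stairArea f c + c * (b - 1) + (a - (1 - c)) * d +
        (1 - c) * (d - f c) := by
      rw [hD, stairArea]
      ring
    refine ⟨by linarith, fun he => ⟨c, hc, by linarith, ?_⟩⟩
    have e1 : b = 1 := by
      have : c * (b - 1) = 0 := by linarith
      linarith [(mul_eq_zero.1 this).resolve_left hc0.ne']
    have e2 : a = 1 - c := by
      have : (a - (1 - c)) * d = 0 := by linarith
      linarith [(mul_eq_zero.1 this).resolve_right hd0.ne']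
    have e3 : d = f c := by
      have : (1 - c) * (d - f c) = 0 := by linarith
      linarith [(mul_eq_zero.1 this).resolve_left (sub_pos.2 hc1).ne']
    rw [hΛ, e1, e2, e3, neg_sub]

theorem stairLattice_injOn {f : ℝ → ℝ} (hcont : ContinuousOn f (Icc 0 1))
    (hlow : ∀ x ∈ Icc (0 : ℝ) 1, 1 - x ≤ f x) (h0 : f 0 = 1) {s : Set ℝ} (hs : s ⊆ Ioc 0 1)
    (hpack : ∀ x ∈ s, IsPacking (translates (region f) (lattice (x - 1, 1) (x, f x)))) :
    InjOn (fun x : ℝ => lattice (x - 1, 1) (x, f x)) s := by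
  have aux : ∀ x ∈ s, ∀ y ∈ s,
      lattice (x - 1, 1) (x, f x) = lattice (y - 1, 1) (y, f y) → ¬x < y := by
    intro x hx y hy he hxy
    have hy1 : (y - 1, (1 : ℝ)) ∈ lattice (x - 1, 1) (x, f x) :=
      he ▸ Submodule.subset_span (mem_insert _ _)
    have hx1 : (x - 1, (1 : ℝ)) ∈ lattice (x - 1, 1) (x, f x) :=
      Submodule.subset_span (mem_insert _ _)
    -- This vector is horizontal and shorter than 1, as `s` omits 0; admissibility excludes it.
    have hd : (y - x, (0 : ℝ)) ∈ lattice (x - 1, 1) (x, f x) := by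
      simpa using sub_mem hy1 hx1
    have := (admissible_of_isPacking hcont hlow h0 (hpack x hx) _ hd
      (fun e => hxy.ne' (sub_eq_zero.1 (congrArg Prod.fst e))) (by simpa using hxy.le)
      (by have := (hs hx).1; have := (hs hy).2; simp only; linarith)).2 le_rfl
    norm_num at this
  intro x hx y hy he
  exact le_antisymm (not_lt.1 (aux y hy x hx he.symm)) (not_lt.1 (aux x hx y hy he))

end ConvexDisk

/-! ### The bijection. -/

open ConvexDisk in
theorem mainTheorem8 (f : ℝ → ℝ)
    (hcont : ContinuousOn f (Set.Icc 0 1))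
    (hconc : ConcaveOn ℝ (Set.Icc 0 1) f)
    (hanti : AntitoneOn f (Set.Icc 0 1))
    (h0 : f 0 = 1) (h1 : 0 ≤ f 1)
    (hsq : ConvexDisk.region f ≠ Set.Icc (0 : ℝ) 1 ×ˢ Set.Icc (0 : ℝ) 1) :
    Set.BijOn (fun x : ℝ => ConvexDisk.lattice (x - 1, 1) (x, f x))
      (ConvexDisk.minimizers f)
      (ConvexDisk.optimalPackingLattices (ConvexDisk.region f)) := by
  have hlow : ∀ x ∈ Icc (0 : ℝ) 1, 1 - x ≤ f x := fun x => one_sub_le_of_concaveOn hconc h0 h1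
  have hpos : ∀ x, 0 ≤ x → x < 1 → 0 < f x := fun x hx hx1 =>
    (sub_pos.2 hx1).trans_le (hlow x ⟨hx, hx1.le⟩)
  have hf : ∀ x ∈ Icc (0 : ℝ) 1, 0 ≤ f x ∧ f x ≤ 1 := fun x hx =>
    ⟨(sub_nonneg.2 hx.2).trans (hlow x hx), h0 ▸ hanti (left_mem_Icc.2 zero_le_one) hx hx.1⟩
  obtain ⟨z, hz, hzmin⟩ : ∃ z ∈ Icc (0 : ℝ) 1, ∀ t ∈ Icc (0 : ℝ) 1, stairArea f z ≤ stairArea f t :=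
    isCompact_Icc.exists_isMinOn (nonempty_Icc.2 zero_le_one)
      ((continuousOn_id.add hcont).sub (continuousOn_id.mul hcont))
  obtain ⟨t, ht, ht1⟩ := exists_stairArea_lt_one hcont hanti h0 hsq
  set m := stairArea f z with hm
  have hm1 : m < 1 := (hzmin t ht).trans_lt ht1
  have hm0 : 0 < m := by
    rcases eq_or_lt_of_le hz.1 with h | h
    · simp [hm, stairArea, ← h, h0]
    · rw [hm, stairArea]
      nlinarith [mul_nonneg (sub_nonneg.2 hz.2) (hf z hz).1]
  have hmem : ∀ x, x ∈ minimizers f ↔ x ∈ Icc (0 : ℝ) 1 ∧ stairArea f x = m := fun x => by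
    rw [mem_minimizers_iff hf]
    exact and_congr_right fun hx => ⟨fun h => (h z hz).antisymm (hzmin x hx), fun h => h ▸ hzmin⟩
  have hpack : ∀ x ∈ minimizers f,
      IsPacking (translates (region f) (lattice (x - 1, 1) (x, f x))) := fun x hx =>
    isPacking_stairLattice hanti h0 hx.1 (hf x hx.1).1
  have hbdd : Bornology.IsBounded (region f) :=
    (isCompact_Icc.prod isCompact_Icc).isBounded.subset (region_subset_square hanti h0)
  have hne : (interior (region f)).Nonempty :=
    ((eventually_corner hcont le_rfl zero_lt_one le_rfl (h0 ▸ zero_lt_one)).exists).imp' _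
      fun _ h => h
  have hv0 : volume (region f) ≠ 0 := (Measure.measure_pos_of_nonempty_interior _ hne).ne'
  have hvt : volume (region f) ≠ ∞ := hbdd.measure_lt_top.ne
  have hdens : ∀ {v w : ℝ × ℝ}, cross v w ≠ 0 → HasDensity (translates (region f) (lattice v w))
      (volume (region f) / ENNReal.ofReal |cross v w|) :=
    fun h => hasDensity_translates hbdd (hne.mono interior_subset) h
  have hcross : ∀ x ∈ minimizers f, |cross (x - 1, 1) (x, f x)| = m := fun x hx =>
    (abs_cross_stairLattice hx.1 (hf x hx.1).1).trans ((hmem x).1 hx).2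
  have hcross0 : ∀ x ∈ minimizers f, cross (x - 1, 1) (x, f x) ≠ 0 := fun x hx e => by
    have := hcross x hx
    rw [e, abs_zero] at this
    exact hm0.ne this
  have hlattice : ∀ x ∈ minimizers f, IsLattice (lattice (x - 1, 1) (x, f x)) := fun x hx =>
    ⟨_, _, linearIndependent_pair_iff_cross_ne_zero.2 (hcross0 x hx), rfl⟩
  have hδ : latticePackingDensity (region f) = volume (region f) / ENNReal.ofReal m := by
    refine le_antisymm (sSup_le ?_) (le_sSup ?_)
    · rintro _ ⟨_, ⟨v, w, hvw, rfl⟩, hp, rfl⟩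
      have hc := linearIndependent_pair_iff_cross_ne_zero.1 hvw
      rw [(hdens hc).1]
      exact ENNReal.div_le_div_left (ENNReal.ofReal_le_ofReal
        ((admissible_of_isPacking hcont hlow h0 hp).le_abs_cross hc hpos hm1 hzmin).1) _
    · have hz' : z ∈ minimizers f := (hmem z).2 ⟨hz, rfl⟩
      exact ⟨_, hlattice z hz', hpack z hz', by rw [(hdens (hcross0 z hz')).1, hcross z hz']⟩
  refine ⟨fun x hx => ⟨hlattice x hx, hpack x hx, ?_⟩,
    stairLattice_injOn hcont hlow h0 (fun x hx => ⟨hx.1.1.lt_of_ne fun e => ?_, hx.1.2⟩) hpack, ?_⟩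
  · rw [hδ, ← hcross x hx]
    exact hdens (hcross0 x hx)
  -- The point 0 is no minimizer, since `stairArea f 0 = 1 > m`.
  · have := ((hmem x).1 hx).2
    rw [← e, stairArea, h0] at this
    linarith
  · rintro _ ⟨⟨v, w, hvw, rfl⟩, hp, hd⟩
    have hc := linearIndependent_pair_iff_cross_ne_zero.1 hvw
    -- Optimal density means determinant `m`, as the area of the region is neither 0 nor infinite.
    have he := (hdens hc).1.symm.trans (hd.1.trans hδ)
    rw [div_eq_mul_inv, div_eq_mul_inv, ENNReal.mul_right_inj hv0 hvt, inv_inj,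
      ENNReal.ofReal_eq_ofReal_iff (abs_nonneg _) hm0.le] at he
    obtain ⟨x, hx, hxm, hΛ⟩ :=
      ((admissible_of_isPacking hcont hlow h0 hp).le_abs_cross hc hpos hm1 hzmin).2 he
    exact ⟨x, (hmem x).2 ⟨hx, hxm⟩, hΛ.symm⟩
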